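/- **Conventions.** Categories are locally small. For a regular cardinal $\kappa$, a poset is *$\kappa$-directed* if each of its subsets of cardinality $<\kappa$ has an upper bound, and an object $M$ of a category $\mathcal K$ is *$\kappa$-presentable* if $\mathrm{Hom}(M,-)$ preserves colimits of $\kappa$-directed diagrams. The *presentability rank* of $M$ is the least regular $\kappa$ such that $M$ is $\kappa$-presentable. For an infinite cardinal $\lambda$, $M$ is *$(<\lambda)$-presentable* if it is $\kappa$-presentable for some regular $\kappa<\lambda+\aleph_1$. For regular $\mu,\theta$, the category $\mathcal K$ is *$(\mu,\theta)$-accessible* if it has $\mu$-directed colimits, has only a set of $\theta$-presentable objects up to isomorphism, and every object is the colimit of a $\mu$-directed diagram of $\theta$-presentable objects; it is *$\mu$-accessible* if it is $(\mu,\mu)$-accessible, and *accessible* if it is $\kappa$-accessible for some regular $\kappa$. For regular $\mu<\lambda$, write $\mu\triangleleft\lambda$ if for every cardinal $\theta<\lambda$ the poset $[\theta]^{<\mu}$ of subsets of $\theta$ of cardinality $<\mu$, ordered by inclusion, has a cofinal subset of cardinality $<\lambda$. For $\mu$ regular and $\lambda$ singular, write $\mu\triangleleft\lambda$ if for every $\lambda_0<\lambda$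 there is a regular $\lambda_0'\in(\lambda_0,\lambda]$ with $\mu\triangleleft\lambda_0'$. An object $M$ is *filtrable* if it has a presentability rank $\rho$ and there are a regular cardinal $\kappa<\rho$ and a diagram $\langle M_i : i<\kappa\rangle$ of $(<\rho)$-presentable objects, indexed by the well-ordered set $\kappa$, with colimit $M$. For a regular cardinal $\rho$, an accessible category is *$\rho$-filtrable* if each of its objects of presentability rank $\rho$ is filtrable, and *almost $\rho$-filtrable* if each of its objects of presentability rank $\rho$ is a retract of a filtrable $\rho$-presentable object. **Theorem.** Let $\mu$ be a regular cardinal. Let $\lambda$ be an infinite cardinal such that $\mu\triangleleft\lambda$ and $\mu\triangleleft\lambda^+$. Then: 1. If $\mathcal K$ is a $(\mu,\theta)$-accessible category for some regular $\theta\le\lambda$, then $\mathcal K$ is (accessible and) almost $\lambda^+$-filtrable. 2. Every $\mu$-accessible category is $\lambda^+$-filtrable. Moreover (without reference to $\lambda$): 3. Every $\mu$-accessible category is $\mu^+$-filtrable. -/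

import Mathlib

universe w v u

open CategoryTheory Limits Cardinal

namespace Filtration

/-! Throughout, cardinals live in a universe `w`, "small" means `w`-small, and categories are
arbitrary (the accessible ones are locally `w`-small). -/

section SetTheory

/-- The poset `[X]^{<μ}` of subsets of `X` of cardinality less than `μ`, ordered by inclusion. -/
abbrev SmallSubsets (μ : Cardinal.{w}) (X : Type w) : Type w :=
  {s : Set X // #s < μ}

/-- The relation `μ ◁ ν` for regular cardinals `μ < ν`: the cofinality of the poset `[X]^{<μ}`
is less than `ν` for every set `X` of cardinality less than `ν`. -/
structure SharplyLTRegular (μ ν : Cardinal.{w}) : Prop where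
  regular_left : μ.IsRegular
  regular_right : ν.IsRegular
  lt : μ < ν
  cof_lt : ∀ X : Type w, #X < ν → Order.cof (SmallSubsets μ X) < ν

/-- The relation `μ ◁ ν` for `μ` regular and `ν` an arbitrary infinite cardinal. For `ν` singular
it means that for every `ν₀ < ν` there is a regular `ν₁ ∈ (ν₀, ν]` with `μ ◁ ν₁`. -/
def SharplyLT (μ ν : Cardinal.{w}) : Prop :=
  SharplyLTRegular μ ν ∨
    (ℵ₀ ≤ ν ∧ ¬ ν.IsRegular ∧ ∀ ν₀ < ν, ∃ ν₁, ν₀ < ν₁ ∧ ν₁ ≤ ν ∧ SharplyLTRegular μ ν₁)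

end SetTheory

section Presentability

variable (K : Type u) [Category.{v} K]

/-- The objects that are `κ`-presentable (with `κ` a regular cardinal). -/
def presentable (κ : Cardinal.{w}) : ObjectProperty K :=
  fun X ↦ ∃ _ : Fact κ.IsRegular, IsCardinalPresentable X κ

/-- The `(<ν)`-presentable objects: those that are `κ`-presentable for some regular
`κ < ν + ℵ₁`. -/
def presentableLT (ν : Cardinal.{w}) : ObjectProperty K :=
  fun X ↦ ∃ κ < ν + ℵ₁, presentable K κ X

variable {K} in
/-- `κ` is the presentability rank of `X`: the least regular cardinal `κ` such that `X` is
`κ`-presentable. -/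
def HasPresentabilityRank (X : K) (κ : Cardinal.{w}) : Prop :=
  IsLeast {κ' : Cardinal.{w} | presentable K κ' X} κ

/-- `X` is the colimit of a `(μ, <ν)`-system, i.e. of a diagram of `(<ν)`-presentable objects
indexed by a small `μ`-directed poset. -/
def IsColimitOfSystem (μ : Cardinal.{w}) [Fact μ.IsRegular] (ν : Cardinal.{w}) (X : K) : Prop :=
  ∃ (I : Type w) (_ : PartialOrder I) (_ : IsCardinalFiltered I μ),
    (presentableLT K ν).colimitsOfShape I X

/-- `(μ, <ν)`-accessible categories. The existence of `μ`-directed colimits is expressed through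
the (equivalent) existence of `μ`-filtered colimits. -/
structure IsAccessibleLT (μ : Cardinal.{w}) [Fact μ.IsRegular] (ν : Cardinal.{w}) : Prop where
  locallySmall : LocallySmall.{w} K
  hasColimits : HasCardinalFilteredColimits.{w} K μ
  essentiallySmall : ObjectProperty.EssentiallySmall.{w} (presentableLT K ν)
  isColimitOfSystem : ∀ X : K, IsColimitOfSystem K μ ν X

/-- `(μ, θ)`-accessible categories, for `θ` regular. -/
def IsAccessiblePair (μ : Cardinal.{w}) [Fact μ.IsRegular] (θ : Cardinal.{w}) : Prop :=
  θ.IsRegular ∧ IsAccessibleLT K μ (Order.succ θ)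

end Presentability

section Filtrations

variable {K : Type u} [Category.{v} K]

/-- `X` is the colimit of a `(<ν)`-chain, i.e. of a diagram of `(<ν)`-presentable objects indexed
by (the well-order) `κ` for some regular cardinal `κ < ν`. -/
def IsColimitOfChain (ν : Cardinal.{w}) (X : K) : Prop :=
  ∃ κ : Cardinal.{w}, κ.IsRegular ∧ κ < ν ∧
    (presentableLT K ν).colimitsOfShape κ.ord.ToType X

/-- `X` is filtrable: it has a presentability rank `ρ`, and it is the colimit of a
`(<ρ)`-chain. -/
def IsFiltrable (X : K) : Prop :=
  ∃ ρ : Cardinal.{w}, HasPresentabilityRank X ρ ∧ IsColimitOfChain ρ X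

variable (K) in
/-- `K` is a `ν`-filtrable accessible category. -/
structure IsFiltrableCategory (ν : Cardinal.{w}) : Prop where
  accessible : IsAccessibleCategory.{w} K
  filtrable : ∀ X : K, HasPresentabilityRank X ν → IsFiltrable.{w} X

variable (K) in
/-- `K` is an almost `ν`-filtrable accessible category. -/
structure IsAlmostFiltrableCategory (ν : Cardinal.{w}) : Prop where
  accessible : IsAccessibleCategory.{w} K
  exists_retract : ∀ X : K, HasPresentabilityRank X ν →
    ∃ Y : K, IsFiltrable.{w} Y ∧ presentable K ν Y ∧ Nonempty (Retract X Y)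

end Filtrations

end Filtration

/-! If `μ ◁ ρ`, every subset of size `< ρ` of a `μ`-directed poset `I` lies in a `μ`-directed one of
size `< ρ`, so a `μ`-directed colimit over `I` is also the `ρ`-directed colimit of its partial
colimits along such subsets. For `ρ = ν⁺` this presents a `ρ`-presentable object `X` as a retract
of one partial colimit. Enlarging that partial colimit along a chain of length `μ` which absorbs the
resulting idempotents shows that `X` itself is a `μ`-directed colimit over a subset `A` of size at
most `ν`, without passing to a retract. If `μ ◁ ν`, writing `A` as the union of a chain of length
`cof ν` of `μ`-directed subsets of size `< ν` exhibits `X` as the colimit of a chain of partial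
colimits; if `μ = ν`, the directed set `A` has a cofinal chain of length `μ`. -/

namespace Filtration

section DirectedSets

variable {κ : Cardinal.{w}} [Fact κ.IsRegular]

lemma mk_Iio_ord_lt {ν : Cardinal.{w}} (i : ν.ord.ToType) : #(Set.Iio i) < ν := by
  simpa using mk_Iio_lt i

lemma mk_iUnion_lt_of_lt_cof {ν : Cardinal.{w}} (hν : ℵ₀ ≤ ν) {ι α : Type w} (s : ι → Set α)
    (hι : #ι < ν.ord.cof) (hs : ∀ i, #(s i) < ν) : #(⋃ i, s i) < ν :=
  (mk_iUnion_le _).trans_lt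
    (mul_lt_of_lt hν (hι.trans_le (Ordinal.cof_ord_le ν)) (iSup_lt_of_lt_cof_ord hι hs))

lemma exists_embedding_ord_toType {I : Type w} {ν : Cardinal.{w}} (hI : #I ≤ ν) :
    Nonempty (I ↪ ν.ord.ToType) := by
  rw [← Cardinal.le_def]
  simpa using hI

lemma exists_orderHom_ord_toType {P : Type*} [Preorder P] [IsCardinalFiltered P κ]
    (g : κ.ord.ToType → P) {e : P → P} (he : ∀ p, p ≤ e p) :
    ∃ f : κ.ord.ToType →o P, (∀ i, g i ≤ f i) ∧ ∀ i j, i < j → e (f i) ≤ f j := by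
  have hlt (i : κ.ord.ToType) : HasCardinalLT (Option (Set.Iio i)) κ := by
    rw [hasCardinalLT_option_iff _ _ (IsRegular.aleph0_le Fact.out),
      hasCardinalLT_iff_cardinal_mk_lt]
    exact mk_Iio_ord_lt i
  have hbound (i : κ.ord.ToType) (p : Set.Iio i → P) :
      ∃ b, g i ≤ b ∧ ∀ j, e (p j) ≤ b :=
    let s : Option (Set.Iio i) → P := fun o ↦ o.elim (g i) (e ∘ p)
    ⟨IsCardinalFiltered.max s (hlt i), leOfHom (IsCardinalFiltered.toMax s (hlt i) none),
      fun j ↦ leOfHom (IsCardinalFiltered.toMax s (hlt i) (some j))⟩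
  choose b hgb heb using hbound
  let f : κ.ord.ToType → P := wellFounded_lt.fix fun i ih ↦ b i fun j ↦ ih j j.2
  have hf (i : κ.ord.ToType) : f i = b i fun j ↦ f j := wellFounded_lt.fix_eq _ i
  have hef (i j : κ.ord.ToType) (hij : i < j) : e (f i) ≤ f j := by
    rw [hf j]
    exact heb j (fun k ↦ f k) ⟨i, hij⟩
  refine ⟨⟨f, fun i j hij ↦ ?_⟩, fun i ↦ ?_, hef⟩
  · obtain rfl | hij := hij.eq_or_lt
    · exact le_rfl
    · exact (he _).trans (hef i j hij)
  · exact (hgb i _).trans_eq (hf i).symm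

lemma isCardinalFiltered_iUnion {Q : Type*} [Preorder Q] [IsCardinalFiltered Q κ]
    {I : Type w} [Preorder I] (S : Q →o Set I) (hS : ∀ q, IsCardinalFiltered (S q) κ) :
    IsCardinalFiltered (⋃ q, S q : Set I) κ :=
  isCardinalFiltered_preorder _ _ fun ι a hι ↦ by
    have hι' : HasCardinalLT ι κ := (hasCardinalLT_iff_cardinal_mk_lt _ _).2 hι
    choose q hq using fun i ↦ Set.mem_iUnion.1 (a i).2
    let q' := IsCardinalFiltered.max q hι'
    have := hS q'
    let b (i : ι) : S q' :=
      ⟨a i, S.monotone (leOfHom (IsCardinalFiltered.toMax q hι' i)) (hq i)⟩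
    let m : S q' := IsCardinalFiltered.max b hι'
    exact ⟨⟨m, Set.mem_iUnion_of_mem q' m.2⟩,
      fun i ↦ leOfHom (IsCardinalFiltered.toMax b hι' i)⟩

lemma exists_cofinal_orderHom_ord_toType {I : Type w} [Preorder I] [IsCardinalFiltered I κ]
    (hI : #I ≤ κ) : ∃ f : κ.ord.ToType →o I, ∀ x, ∃ i, x ≤ f i := by
  have := IsCardinalFiltered.nonempty I κ
  obtain ⟨e⟩ := exists_embedding_ord_toType hI
  obtain ⟨f, hf, -⟩ := exists_orderHom_ord_toType (Function.invFun e) (e := id) fun _ ↦ le_rfl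
  exact ⟨f, fun x ↦ ⟨e x, (Function.leftInverse_invFun e.injective x).ge.trans (hf (e x))⟩⟩

lemma exists_cover_ord_cof {ν : Cardinal.{w}} (hν : ℵ₀ ≤ ν) {I : Type w} (hI : #I ≤ ν) :
    ∃ B : ν.ord.cof.ord.ToType → Set I, (∀ i, #(B i) < ν) ∧ ∀ x, ∃ i, x ∈ B i := by
  obtain ⟨e⟩ := exists_embedding_ord_toType hI
  obtain ⟨s, hs, hs'⟩ := Order.exists_cof_eq ν.ord.ToType
  obtain ⟨g⟩ : Nonempty (ν.ord.cof.ord.ToType ≃ s) := by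
    rw [← Cardinal.eq, hs']
    simp only [mk_ord_toType, Ordinal.cof_toType]
  have : NoMaxOrder ν.ord.ToType := Cardinal.noMaxOrder hν
  refine ⟨fun i ↦ e ⁻¹' Set.Iio (g i).1, fun i ↦
    (mk_preimage_of_injective _ _ e.injective).trans_lt (mk_Iio_ord_lt _), fun x ↦ ?_⟩
  obtain ⟨y, hy⟩ := exists_gt (e x)
  obtain ⟨z, hz, hyz⟩ := hs y
  exact ⟨g.symm ⟨z, hz⟩, by simpa using hy.trans_le hyz⟩

end DirectedSets

section SharplyLT

variable {μ ν ρ : Cardinal.{w}}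

lemma SharplyLT.aleph0_le (h : SharplyLT μ ν) : ℵ₀ ≤ ν := by
  obtain h | h := h
  exacts [h.regular_right.aleph0_le, h.1]

lemma SharplyLT.exists_regular (h : SharplyLT μ ν) {ν₀ : Cardinal.{w}} (h₀ : ν₀ < ν) :
    ∃ ν₁, ν₀ < ν₁ ∧ ν₁ ≤ ν ∧ SharplyLTRegular μ ν₁ := by
  obtain h | h := h
  exacts [⟨ν, h₀, le_rfl, h⟩, h.2.2 _ h₀]

lemma SharplyLTRegular.sharplyLT (h : SharplyLTRegular μ ν) : SharplyLT μ ν := Or.inl h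

lemma SharplyLT.le (h : SharplyLT μ ν) : μ ≤ ν := by
  obtain ⟨ν₁, -, hν₁, h₁⟩ := h.exists_regular (aleph0_pos.trans_le h.aleph0_le)
  exact h₁.lt.le.trans hν₁

lemma SharplyLT.exists_regular_ge (h : SharplyLT μ ν) {α θ : Cardinal.{w}} (hα : α < ν)
    (hθ : θ.IsRegular) (hθν : θ ≤ ν) : ∃ κ, κ.IsRegular ∧ α < κ ∧ θ ≤ κ ∧ κ ≤ ν := by
  obtain rfl | hθν := hθν.eq_or_lt
  · exact ⟨θ, hθ, hα, le_rfl, le_rfl⟩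
  · obtain ⟨κ, hκ, hκν, hμκ⟩ := h.exists_regular (max_lt hα hθν)
    exact ⟨κ, hμκ.regular_right, (le_max_left _ _).trans_lt hκ, (le_max_right _ _).trans hκ.le,
      hκν⟩

lemma SharplyLT.sharplyLTRegular_succ (h : SharplyLT μ (Order.succ ν)) (hν : ℵ₀ ≤ ν) :
    SharplyLTRegular μ (Order.succ ν) :=
  h.resolve_right fun h ↦ h.2.1 (isRegular_succ hν)

lemma sharplyLTRegular_succ_self [Fact μ.IsRegular] : SharplyLTRegular μ (Order.succ μ) where
  regular_left := Fact.out
  regular_right := isRegular_succ (IsRegular.aleph0_le Fact.out)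
  lt := Order.lt_succ μ
  cof_lt X hX := by
    obtain ⟨e⟩ := exists_embedding_ord_toType (Order.lt_succ_iff.1 hX)
    have : NoMaxOrder μ.ord.ToType := Cardinal.noMaxOrder (IsRegular.aleph0_le Fact.out)
    let initial (i : μ.ord.ToType) : SmallSubsets μ X :=
      ⟨e ⁻¹' Set.Iio i, (mk_preimage_of_injective _ _ e.injective).trans_lt (mk_Iio_ord_lt i)⟩
    have hcofinal : IsCofinal (Set.range initial) := fun s ↦ by
      have hs : HasCardinalLT s.1 μ := (hasCardinalLT_iff_cardinal_mk_lt _ _).2 s.2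
      obtain ⟨i, hi⟩ := exists_gt (IsCardinalFiltered.max (fun x : s.1 ↦ e x) hs)
      exact ⟨initial i, ⟨i, rfl⟩, fun x hx ↦
        (leOfHom (IsCardinalFiltered.toMax (fun x : s.1 ↦ e x) hs ⟨x, hx⟩)).trans_lt hi⟩
    calc Order.cof (SmallSubsets μ X) ≤ #(Set.range initial) := Order.cof_le hcofinal
      _ ≤ #(μ.ord.ToType) := mk_range_le
      _ = μ := mk_ord_toType μ
      _ < Order.succ μ := Order.lt_succ μ

variable [Fact μ.IsRegular] {I : Type w} [PartialOrder I]

lemma SharplyLTRegular.exists_directed_superset (h : SharplyLTRegular μ ρ)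
    [IsCardinalFiltered I μ] (Z : Set I) (hZ : #Z < ρ) :
    ∃ A : Set I, Z ⊆ A ∧ IsCardinalFiltered A μ ∧ #A < ρ := by
  have : Fact ρ.IsRegular := ⟨h.regular_right⟩
  simp only [← hasCardinalLT_iff_cardinal_mk_lt] at hZ ⊢
  refine SharplyLT.exists_isCardinalFiltered_set_of_exists_cofinal h.lt (fun X hX ↦ ?_) Z hZ
  obtain ⟨s, hs, hs'⟩ := Order.exists_cof_eq (SmallSubsets μ X)
  let e (t : SmallSubsets μ X) : CardinalDirectedPoset.SetCardinalLT μ X :=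
    ⟨t.1, (hasCardinalLT_iff_cardinal_mk_lt _ _).2 t.2⟩
  refine ⟨e '' s, ?_, fun t ↦ ?_⟩
  · rw [hasCardinalLT_iff_cardinal_mk_lt]
    exact mk_image_le.trans_lt (hs'.trans_lt
      (h.cof_lt X ((hasCardinalLT_iff_cardinal_mk_lt _ _).1 hX)))
  · obtain ⟨t', ht', hle⟩ := hs ⟨t.1, (hasCardinalLT_iff_cardinal_mk_lt _ _).1 t.2⟩
    exact ⟨e t', ⟨t', ht', rfl⟩, hle⟩

lemma SharplyLT.exists_directed_superset (h : SharplyLT μ ν) [IsCardinalFiltered I μ]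
    (Z : Set I) (hZ : #Z < ν) : ∃ A : Set I, Z ⊆ A ∧ IsCardinalFiltered A μ ∧ #A < ν := by
  obtain ⟨ν₁, hZν₁, hν₁, h₁⟩ := h.exists_regular hZ
  obtain ⟨A, hZA, hA, hAν₁⟩ := h₁.exists_directed_superset Z hZν₁
  exact ⟨A, hZA, hA, hAν₁.trans_le hν₁⟩

variable (μ ν I) in
/-- The poset of `μ`-directed subsets of `I` of cardinality less than `ν`, ordered by inclusion.
It indexes the decomposition of a `μ`-directed colimit over `I` into smaller ones. -/
abbrev SmallDirectedSubsets : Type w :=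
  {A : Set I // IsCardinalFiltered A μ ∧ #A < ν}

lemma SharplyLT.exists_smallDirectedSubsets_superset (h : SharplyLT μ ν) [IsCardinalFiltered I μ]
    (Z : Set I) (hZ : #Z < ν) : ∃ A : SmallDirectedSubsets μ ν I, Z ⊆ A.1 := by
  obtain ⟨A, hZA, hA⟩ := h.exists_directed_superset Z hZ
  exact ⟨⟨A, hA⟩, hZA⟩

lemma SharplyLT.exists_smallDirectedSubsets_mem (h : SharplyLT μ ν) [IsCardinalFiltered I μ]
    (a : I) : ∃ A : SmallDirectedSubsets μ ν I, a ∈ A.1 := by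
  obtain ⟨A, hA⟩ := h.exists_smallDirectedSubsets_superset {a}
    (by simpa only [mk_singleton] using one_lt_aleph0.trans_le h.aleph0_le)
  exact ⟨A, hA rfl⟩

lemma SharplyLT.isCardinalFiltered_smallDirectedSubsets (h : SharplyLT μ ν)
    [IsCardinalFiltered I μ] {κ : Cardinal.{w}} [Fact κ.IsRegular] (hκ : κ ≤ ν.ord.cof) :
    IsCardinalFiltered (SmallDirectedSubsets μ ν I) κ :=
  isCardinalFiltered_preorder _ _ fun ι f hι ↦ by
    obtain ⟨A, hA⟩ := h.exists_smallDirectedSubsets_superset (⋃ i, (f i).1)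
      (mk_iUnion_lt_of_lt_cof h.aleph0_le _ (hι.trans_le hκ) fun i ↦ (f i).2.2)
    exact ⟨A, fun i ↦ (Set.subset_iUnion (fun i ↦ (f i).1) i).trans hA⟩

lemma SharplyLTRegular.isCardinalFiltered_smallDirectedSubsets [Fact ρ.IsRegular]
    (h : SharplyLTRegular μ ρ) [IsCardinalFiltered I μ] :
    IsCardinalFiltered (SmallDirectedSubsets μ ρ I) ρ :=
  h.sharplyLT.isCardinalFiltered_smallDirectedSubsets h.regular_right.cof_ord.ge

lemma SharplyLT.exists_chain_smallDirectedSubsets (h : SharplyLT μ ν) [IsCardinalFiltered I μ]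
    (hI : #I ≤ ν) :
    ∃ f : ν.ord.cof.ord.ToType →o SmallDirectedSubsets μ ν I, ∀ x, ∃ i, x ∈ (f i).1 := by
  have : Fact ν.ord.cof.IsRegular := ⟨isRegular_cof (isSuccLimit_ord h.aleph0_le)⟩
  have := h.isCardinalFiltered_smallDirectedSubsets (I := I) le_rfl
  obtain ⟨B, hB, hcover⟩ := exists_cover_ord_cof h.aleph0_le hI
  choose A hA using fun i ↦ h.exists_smallDirectedSubsets_superset (B i) (hB i)
  obtain ⟨f, hf, -⟩ := exists_orderHom_ord_toType A (e := id) fun _ ↦ le_rfl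
  exact ⟨f, fun x ↦ (hcover x).imp fun i hi ↦ hf i (hA i hi)⟩

end SharplyLT

section PartialColimits

variable {K : Type u} [Category.{v} K] {I : Type w} [Preorder I]

/-- The restriction of a diagram to a subset of the indexing preorder. -/
abbrev restrict (D : I ⥤ K) (A : Set I) : A ⥤ K where
  obj a := D.obj a.1
  map {a b} f := D.map (homOfLE (leOfHom f) : a.1 ⟶ b.1)
  map_id a := D.map_id a.1
  map_comp _ _ := D.map_comp _ _

/-- The restriction of a cocone to a smaller subset of the indexing preorder. -/
abbrev restrictCocone {D : I ⥤ K} {A B : Set I} (h : A ⊆ B) (t : Cocone (restrict D B)) :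
    Cocone (restrict D A) where
  pt := t.pt
  ι :=
    { app a := t.ι.app ⟨a.1, Set.mem_of_subset_of_mem h a.2⟩
      naturality a b f := t.ι.naturality
        (homOfLE (leOfHom f) : (⟨a.1, Set.mem_of_subset_of_mem h a.2⟩ : B) ⟶
          ⟨b.1, Set.mem_of_subset_of_mem h b.2⟩) }

/-- A cocone over a diagram, seen over its restriction to the whole indexing preorder. -/
abbrev univCocone {D : I ⥤ K} (c : Cocone D) : Cocone (restrict D Set.univ) where
  pt := c.pt
  ι :=
    { app a := c.ι.app a.1
      naturality _ _ f := c.ι.naturality (homOfLE (leOfHom f)) }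

def isColimitUnivCocone {D : I ⥤ K} {c : Cocone D} (hc : IsColimit c) :
    IsColimit (univCocone c) :=
  hc.whiskerEquivalence (OrderIso.Set.univ (α := I)).equivalence

lemma hasColimit_restrict (μ : Cardinal.{w}) [Fact μ.IsRegular]
    [HasCardinalFilteredColimits.{w} K μ] (D : I ⥤ K) (A : Set I) [IsCardinalFiltered A μ] :
    HasColimit (restrict D A) := by
  have := HasCardinalFilteredColimits.hasColimitsOfShape (κ := μ) K A
  infer_instance

lemma hasCardinalLT_arrow_of_preorder {J : Type w} [Preorder J] {κ : Cardinal.{w}}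
    (hκ : ℵ₀ ≤ κ) (hJ : #J < κ) : HasCardinalLT (Arrow J) κ := by
  have hJ' := (hasCardinalLT_iff_cardinal_mk_lt _ _).2 hJ
  refine (hasCardinalLT_prod hκ hJ' hJ').of_injective (fun f ↦ (f.left, f.right)) ?_
  rintro ⟨a, b, f⟩ ⟨a', b', f'⟩ h
  obtain ⟨rfl, rfl⟩ := Prod.mk.inj h
  obtain rfl : f = f' := Subsingleton.elim _ _
  rfl

variable {Q : Type*} [Preorder Q] (D : I ⥤ K) (S : Q →o Set I)
  [∀ q, HasColimit (restrict D (S q))]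

/-- The diagram of the colimits of the restrictions of `D` to an increasing family of subsets of
the indexing preorder. -/
noncomputable def partialColimit : Q ⥤ K where
  obj q := colimit (restrict D (S q))
  map {p q} f := colimit.desc (restrict D (S p))
    (restrictCocone (S.monotone (leOfHom f)) (colimit.cocone (restrict D (S q))))
  map_id q := colimit.hom_ext fun a ↦ (colimit.ι_desc _ _).trans (Category.comp_id _).symm
  map_comp {p q r} f g := colimit.hom_ext fun a ↦ by
    rw [colimit.ι_desc, colimit.ι_desc_assoc]
    exact (colimit.ι_desc (restrictCocone (S.monotone (leOfHom g))
      (colimit.cocone (restrict D (S r)))) ⟨a.1, _⟩).symm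

/-- The coprojection of a member of the diagram to a partial colimit. -/
noncomputable def partialι {q : Q} {a : I} (ha : a ∈ S q) :
    D.obj a ⟶ (partialColimit D S).obj q :=
  colimit.ι (restrict D (S q)) ⟨a, ha⟩

variable {D S}

lemma partialι_map {p q : Q} (f : p ⟶ q) {a : I} (ha : a ∈ S p) :
    partialι D S ha ≫ (partialColimit D S).map f =
      partialι D S (Set.mem_of_subset_of_mem (S.monotone (leOfHom f)) ha) :=
  colimit.ι_desc _ _

lemma map_partialι {q : Q} {a b : I} (ha : a ∈ S q) (hb : b ∈ S q) (f : a ⟶ b) :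
    D.map f ≫ partialι D S hb = partialι D S ha := by
  have hab : (⟨a, ha⟩ : S q) ⟶ ⟨b, hb⟩ := homOfLE (leOfHom f)
  exact colimit.w (restrict D (S q)) hab

lemma partialColimit_hom_ext {q : Q} {T : K} {f g : (partialColimit D S).obj q ⟶ T}
    (h : ∀ a (ha : a ∈ S q), partialι D S ha ≫ f = partialι D S ha ≫ g) : f = g :=
  colimit.hom_ext fun a ↦ h a.1 a.2

/-- The morphism from a partial colimit induced by a cocone over the restriction of the diagram to
a larger set. -/
noncomputable def partialDesc {A : Set I} (t : Cocone (restrict D A)) {q : Q} (hA : S q ⊆ A) :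
    (partialColimit D S).obj q ⟶ t.pt :=
  colimit.desc (restrict D (S q)) (restrictCocone hA t)

lemma partialι_partialDesc {A : Set I} (t : Cocone (restrict D A)) {q : Q} (hA : S q ⊆ A) {a : I}
    (ha : a ∈ S q) :
    partialι D S ha ≫ partialDesc t hA = t.ι.app ⟨a, Set.mem_of_subset_of_mem hA ha⟩ :=
  colimit.ι_desc _ _

/-- The cocone over the partial colimits along subsets of `A` that is induced by a cocone over the
restriction of the diagram to `A`. -/
noncomputable abbrev partialCocone {A : Set I} (hA : ∀ q, S q ⊆ A) (t : Cocone (restrict D A)) :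
    Cocone (partialColimit D S) where
  pt := t.pt
  ι :=
    { app q := partialDesc t (hA q)
      naturality p q f := partialColimit_hom_ext fun a ha ↦ by
        dsimp only [Functor.const_obj_obj, Functor.const_obj_map]
        rw [Category.comp_id, ← Category.assoc, partialι_map, partialι_partialDesc,
          partialι_partialDesc] }

lemma partialι_comp_app_eq [IsDirectedOrder Q] (t : Cocone (partialColimit D S)) {p q : Q} {a : I}
    (hp : a ∈ S p) (hq : a ∈ S q) :
    partialι D S hp ≫ t.ι.app p = partialι D S hq ≫ t.ι.app q := by
  obtain ⟨r, hpr, hqr⟩ := exists_ge_ge p q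
  rw [← t.w (homOfLE hpr), ← t.w (homOfLE hqr), ← Category.assoc, ← Category.assoc,
    partialι_map, partialι_map]

/-- The cocone over the restriction of the diagram to `A` that is induced by a cocone over the
partial colimits along a directed family covering `A`. -/
noncomputable abbrev coconeOfPartial [IsDirectedOrder Q] {A : Set I}
    (hcover : ∀ a : A, ∃ q, a.1 ∈ S q) (t : Cocone (partialColimit D S)) :
    Cocone (restrict D A) where
  pt := t.pt
  ι :=
    { app a := partialι D S (hcover a).choose_spec ≫ t.ι.app (hcover a).choose
      naturality a b f := by
        obtain ⟨q, haq, hbq⟩ := exists_ge_ge (hcover a).choose (hcover b).choose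
        have ha := Set.mem_of_subset_of_mem (S.monotone haq) (hcover a).choose_spec
        have hb := Set.mem_of_subset_of_mem (S.monotone hbq) (hcover b).choose_spec
        rw [partialι_comp_app_eq t _ ha, partialι_comp_app_eq t _ hb, ← Category.assoc]
        exact (map_partialι ha hb _ =≫ _).trans (Category.comp_id _).symm }

noncomputable def isColimitPartialCocone [IsDirectedOrder Q] {A : Set I} (hA : ∀ q, S q ⊆ A)
    (hcover : ∀ a : A, ∃ q, a.1 ∈ S q) {t : Cocone (restrict D A)} (ht : IsColimit t) :
    IsColimit (partialCocone hA t) where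
  desc r := ht.desc (coconeOfPartial hcover r)
  fac r q := partialColimit_hom_ext fun a ha ↦ by
    rw [← Category.assoc, partialι_partialDesc, ht.fac]
    exact partialι_comp_app_eq r _ ha
  uniq r m hm := ht.hom_ext fun a ↦ by
    rw [ht.fac, ← partialι_partialDesc t (hA _) (hcover a).choose_spec, Category.assoc, hm]

noncomputable def isColimitOfPartialCocone {A : Set I} (hA : ∀ q, S q ⊆ A)
    (hcover : ∀ a : A, ∃ q, a.1 ∈ S q) {t : Cocone (restrict D A)}
    (ht : IsColimit (partialCocone hA t)) : IsColimit t where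
  desc r := ht.desc (partialCocone hA r)
  fac r a := by
    obtain ⟨q, hq⟩ := hcover a
    rw [← partialι_partialDesc t (hA q) hq, Category.assoc, ht.fac, partialι_partialDesc]
  uniq r m hm := ht.hom_ext fun q ↦ partialColimit_hom_ext fun a ha ↦ by
    rw [ht.fac, partialι_partialDesc, ← Category.assoc, partialι_partialDesc, hm]

lemma isCardinalPresentable_partialColimit [LocallySmall.{w} K] {κ : Cardinal.{w}}
    [Fact κ.IsRegular] (hD : ∀ a, IsCardinalPresentable (D.obj a) κ) {q : Q} (hq : #(S q) < κ) :
    IsCardinalPresentable ((partialColimit D S).obj q) κ := by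
  have (a : S q) : IsCardinalPresentable ((restrict D (S q)).obj a) κ := hD a.1
  exact isCardinalPresentable_of_isColimit _ (colimit.isColimit (restrict D (S q))) κ
    (hasCardinalLT_arrow_of_preorder (IsRegular.aleph0_le Fact.out) hq)

end PartialColimits

section Sections

variable {K : Type u} [Category.{v} K]

def isColimitOfSection {J : Type*} [Category* J] {F : J ⥤ K} (c : Cocone F) {j₀ : J}
    (s : c.pt ⟶ F.obj j₀) (hs : s ≫ c.ι.app j₀ = 𝟙 c.pt)
    (h : ∀ j, ∃ (k : J) (f : j ⟶ k) (g : j₀ ⟶ k), c.ι.app j ≫ s ≫ F.map g = F.map f) :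
    IsColimit c where
  desc t := s ≫ t.ι.app j₀
  fac t j := by
    obtain ⟨k, f, g, hfg⟩ := h j
    rw [← t.w g, ← t.w f, ← hfg, Category.assoc, Category.assoc]
  uniq t m hm := by rw [← hm j₀, ← Category.assoc, hs, Category.id_comp]

variable {κ ρ : Cardinal.{w}} [Fact ρ.IsRegular] {P : Type w} [Preorder P]
  [IsCardinalFiltered P ρ] {F : P ⥤ K} {c : Cocone F}

lemma exists_map_eq_of_section (hc : IsColimit c) {p₀ : P} {s : c.pt ⟶ F.obj p₀}
    (hs : s ≫ c.ι.app p₀ = 𝟙 c.pt) (p : P) [IsCardinalPresentable (F.obj p) ρ] :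
    ∃ (r : P) (h : p ≤ r) (h₀ : p₀ ≤ r),
      c.ι.app p ≫ s ≫ F.map (homOfLE h₀) = F.map (homOfLE h) := by
  have := isFiltered_of_isCardinalFiltered P ρ
  have := IsFiltered.isDirectedOrder P
  obtain ⟨q, hpq, h₀q⟩ := exists_ge_ge p p₀
  have heq : (c.ι.app p ≫ s ≫ F.map (homOfLE h₀q)) ≫ c.ι.app q =
      F.map (homOfLE hpq) ≫ c.ι.app q := by
    rw [Category.assoc, Category.assoc, c.w, c.w, hs]
    exact Category.comp_id _
  obtain ⟨r, f, hf⟩ := IsCardinalPresentable.exists_eq_of_isColimit' ρ hc _ _ heq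
  refine ⟨r, hpq.trans (leOfHom f), h₀q.trans (leOfHom f), ?_⟩
  rw [Category.assoc, Category.assoc, ← F.map_comp, ← F.map_comp] at hf
  exact hf

/-- Splitting the coprojections one after the other along a chain of length `κ` makes the chain
absorb the idempotents that a section of a coprojection defines. -/
theorem exists_chain_isColimit [Fact κ.IsRegular] (hκ : κ ≤ ρ) (hc : IsColimit c)
    (hF : ∀ p, IsCardinalPresentable (F.obj p) ρ) [IsCardinalPresentable c.pt ρ] :
    ∃ f : κ.ord.ToType →o P, Nonempty (IsColimit (c.whisker f.toFunctor)) := by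
  obtain ⟨p₀, s, hs⟩ := IsCardinalPresentable.exists_hom_of_isColimit ρ hc (𝟙 c.pt)
  have := IsCardinalFiltered.of_le P hκ
  choose e he h₀e heq using fun p ↦ exists_map_eq_of_section (ρ := ρ) hc hs p
  obtain ⟨f, h₀f, hef⟩ := exists_orderHom_ord_toType (κ := κ) (fun _ ↦ p₀) he
  have : Nonempty κ.ord.ToType := IsCardinalFiltered.nonempty _ κ
  have : NoMaxOrder κ.ord.ToType := Cardinal.noMaxOrder (IsRegular.aleph0_le Fact.out)
  let i₀ : κ.ord.ToType := Classical.arbitrary _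
  refine ⟨f, ⟨isColimitOfSection _ (j₀ := i₀) (s ≫ F.map (homOfLE (h₀f i₀))) ?_ fun i ↦ ?_⟩⟩
  · exact (Category.assoc _ _ _).trans ((s ≫= c.w _).trans hs)
  · obtain ⟨j, hj⟩ := exists_gt (max i i₀)
    have hij := (le_max_left i i₀).trans_lt hj
    refine ⟨j, homOfLE hij.le, homOfLE ((le_max_right i i₀).trans hj.le), ?_⟩
    have hsplit := heq (f i) =≫ F.map (homOfLE (hef i j hij))
    rw [Category.assoc, Category.assoc, ← F.map_comp, ← F.map_comp] at hsplit
    refine Eq.trans ?_ hsplit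
    change c.ι.app (f i) ≫ (s ≫ _) ≫ F.map _ = _
    rw [Category.assoc, ← F.map_comp]
    rfl

end Sections

section Presentations

variable {K : Type u} [Category.{v} K] {μ ν ρ : Cardinal.{w}} [Fact μ.IsRegular]

lemma presentable_iff {κ : Cardinal.{w}} [Fact κ.IsRegular] {X : K} :
    presentable K κ X ↔ IsCardinalPresentable X κ :=
  ⟨fun ⟨_, h⟩ ↦ h, fun h ↦ ⟨inferInstance, h⟩⟩

lemma presentableLT_succ_iff (hν : ℵ₀ ≤ ν) {X : K} :
    presentableLT K (Order.succ ν) X ↔ ∃ κ ≤ ν, presentable K κ X := by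
  have h : ℵ₁ ≤ Order.succ ν := by
    rw [← succ_aleph0]
    exact Order.succ_le_succ hν
  simp only [presentableLT, add_eq_left (hν.trans (Order.le_succ ν)) h, Order.lt_succ_iff]

lemma presentableLT_succ_eq (θ : Cardinal.{w}) [Fact θ.IsRegular] :
    presentableLT K (Order.succ θ) = isCardinalPresentable K θ := by
  ext X
  rw [presentableLT_succ_iff (IsRegular.aleph0_le Fact.out)]
  constructor
  · rintro ⟨κ, hκ, _, _⟩
    exact isCardinalPresentable_of_le X hκ
  · intro h
    exact ⟨θ, le_rfl, presentable_iff.2 h⟩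

lemma colimitsOfShape_ord_toType_of_mk_le {P : ObjectProperty K} {X : K} {J : Type w}
    [Preorder J] [IsCardinalFiltered J μ] (hJ : #J ≤ μ) (hX : P.colimitsOfShape J X) :
    P.colimitsOfShape μ.ord.ToType X := by
  obtain ⟨f, hf⟩ := exists_cofinal_orderHom_ord_toType hJ
  have := f.monotone.final_functor_iff.2 hf
  exact ObjectProperty.colimitsOfShape_le_of_final _ f.monotone.functor _ hX

lemma isColimitOfChain_succ_of_mk_le {I : Type w} [Preorder I] [IsCardinalFiltered I μ]
    (hI : #I ≤ μ) {X : K} (hX : (isCardinalPresentable K μ).colimitsOfShape I X) :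
    IsColimitOfChain (Order.succ μ) X :=
  ⟨μ, Fact.out, Order.lt_succ μ,
    (presentableLT_succ_eq (K := K) μ).symm ▸ colimitsOfShape_ord_toType_of_mk_le hI hX⟩

variable {I : Type w} [PartialOrder I]

/-- The increasing family of subsets of `I` underlying an increasing family of `μ`-directed subsets
of cardinality less than `ν`. -/
def underlyingSets {Q : Type*} [Preorder Q] (S : Q →o SmallDirectedSubsets μ ν I) : Q →o Set I :=
  (OrderHom.Subtype.val _).comp S

variable [HasCardinalFilteredColimits.{w} K μ]

instance hasColimit_restrict_underlyingSets {Q : Type*} [Preorder Q]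
    (S : Q →o SmallDirectedSubsets μ ν I) (D : I ⥤ K) (q : Q) :
    HasColimit (restrict D (underlyingSets S q)) :=
  have : IsCardinalFiltered (underlyingSets S q) μ := (S q).2.1
  hasColimit_restrict μ D _

variable [IsCardinalFiltered I μ]

noncomputable def SharplyLTRegular.isColimitPartialCocone (h : SharplyLTRegular μ ρ) {D : I ⥤ K}
    {c : Cocone D} (hc : IsColimit c) :
    IsColimit (partialCocone (S := underlyingSets (OrderHom.id (α := SmallDirectedSubsets μ ρ I)))
      (fun _ ↦ Set.subset_univ _) (univCocone c)) :=
  have : Fact ρ.IsRegular := ⟨h.regular_right⟩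
  have := h.isCardinalFiltered_smallDirectedSubsets (I := I)
  have := isFiltered_of_isCardinalFiltered (SmallDirectedSubsets μ ρ I) ρ
  have := IsFiltered.isDirectedOrder (SmallDirectedSubsets μ ρ I)
  Filtration.isColimitPartialCocone _ (fun a ↦ h.sharplyLT.exists_smallDirectedSubsets_mem a.1)
    (isColimitUnivCocone hc)

variable [LocallySmall.{w} K] {P : ObjectProperty K}

/-- The directed subset is the union of a chain of length `μ` of small directed subsets; it is small
because `μ < ρ`. -/
theorem SharplyLTRegular.exists_small_colimitsOfShape (h : SharplyLTRegular μ ρ)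
    [Fact ρ.IsRegular] (hP : P ≤ isCardinalPresentable K ρ) {X : K} [IsCardinalPresentable X ρ]
    (hX : P.colimitsOfShape I X) :
    ∃ A : Set I, IsCardinalFiltered A μ ∧ #A < ρ ∧ P.colimitsOfShape A X := by
  obtain ⟨p⟩ := hX
  have := h.isCardinalFiltered_smallDirectedSubsets (I := I)
  have : IsCardinalPresentable p.cocone.pt ρ := ‹IsCardinalPresentable X ρ›
  obtain ⟨f, ⟨hf⟩⟩ := exists_chain_isColimit h.lt.le (h.isColimitPartialCocone p.isColimit)
    fun A ↦ isCardinalPresentable_partialColimit (fun a ↦ hP _ (p.prop_diag_obj a)) A.2.2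
  let U : Set I := ⋃ i, underlyingSets f i
  have hU : IsColimit (restrictCocone (Set.subset_univ U) (univCocone p.cocone)) :=
    isColimitOfPartialCocone (Set.subset_iUnion (underlyingSets f))
      (fun a ↦ Set.mem_iUnion.1 a.2) hf
  refine ⟨U, isCardinalFiltered_iUnion _ fun i ↦ (f i).2.1,
    mk_iUnion_lt_of_lt_cof h.regular_right.aleph0_le _ ?_ fun i ↦ (f i).2.2, ⟨{
      diag := restrict p.diag U
      ι := (restrictCocone (Set.subset_univ U) (univCocone p.cocone)).ι
      isColimit := hU
      prop_diag_obj := fun a ↦ p.prop_diag_obj a.1 }⟩⟩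
  rw [mk_ord_toType, h.regular_right.cof_ord]
  exact h.lt

lemma SharplyLT.isColimitOfChain_succ (h : SharplyLT μ ν) {θ : Cardinal.{w}}
    [Fact θ.IsRegular] (hθ : θ ≤ ν) (hP : P ≤ isCardinalPresentable K θ) (hI : #I ≤ ν) {X : K}
    (hX : P.colimitsOfShape I X) : IsColimitOfChain (Order.succ ν) X := by
  obtain ⟨p⟩ := hX
  obtain ⟨f, hf⟩ := h.exists_chain_smallDirectedSubsets hI
  let c := partialCocone (S := underlyingSets f) (fun _ ↦ Set.subset_univ _) (univCocone p.cocone)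
  have hc : IsColimit c :=
    isColimitPartialCocone _ (fun a ↦ hf a.1) (isColimitUnivCocone p.isColimit)
  refine ⟨ν.ord.cof, isRegular_cof (isSuccLimit_ord h.aleph0_le),
    Order.lt_succ_iff.2 (Ordinal.cof_ord_le ν), ⟨{
      diag := partialColimit p.diag (underlyingSets f)
      ι := c.ι
      isColimit := hc
      prop_diag_obj := fun i ↦ (presentableLT_succ_iff h.aleph0_le).2 ?_ }⟩⟩
  obtain ⟨κ, hκ, hfκ, hθκ, hκν⟩ := h.exists_regular_ge (f i).2.2 Fact.out hθ
  have : Fact κ.IsRegular := ⟨hκ⟩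
  exact ⟨κ, hκν, presentable_iff.2 (isCardinalPresentable_partialColimit
    (fun a ↦ isCardinalPresentable_monotone K hθκ _ (hP _ (p.prop_diag_obj a))) hfκ)⟩

end Presentations

section Accessibility

variable {K : Type u} [Category.{v} K] {μ ρ : Cardinal.{w}}

lemma isAccessiblePair_self [Fact μ.IsRegular] [IsCardinalAccessibleCategory K μ] :
    IsAccessiblePair K μ μ := by
  refine ⟨Fact.out, inferInstance, inferInstance, ?_, fun X ↦ ?_⟩
  · rw [presentableLT_succ_eq]
    infer_instance
  · obtain ⟨J, _, _, hX⟩ :=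
      (isCardinalFilteredGenerator_isCardinalPresentable K μ).exists_colimitsOfShape X
    obtain ⟨I, _, _, F, _⟩ := IsCardinalFiltered.exists_cardinal_directed J μ
    refine ⟨I, inferInstance, inferInstance, ?_⟩
    rw [presentableLT_succ_eq]
    exact ObjectProperty.colimitsOfShape_le_of_final _ F _ hX

lemma IsFiltrableCategory.isAlmostFiltrableCategory (h : IsFiltrableCategory K ρ) :
    IsAlmostFiltrableCategory K ρ where
  accessible := h.accessible
  exists_retract X hX := ⟨X, h.filtrable X hX, hX.1, ⟨Retract.refl X⟩⟩

variable [Fact μ.IsRegular] [HasCardinalFilteredColimits.{w} K μ]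

lemma SharplyLTRegular.isCardinalFilteredGenerator_colimitsCardinalClosure [LocallySmall.{w} K]
    [Fact ρ.IsRegular] (h : SharplyLTRegular μ ρ) {P : ObjectProperty K}
    (hP : P ≤ isCardinalPresentable K ρ)
    (hK : ∀ X : K, ∃ (I : Type w) (_ : PartialOrder I) (_ : IsCardinalFiltered I μ),
      P.colimitsOfShape I X) :
    (P.colimitsCardinalClosure ρ).IsCardinalFilteredGenerator ρ where
  le_isCardinalPresentable := ObjectProperty.colimitsCardinalClosure_le _ _
    (fun J _ hJ ↦ isClosedUnderColimitsOfShape_isCardinalPresentable K hJ) hP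
  exists_colimitsOfShape X := by
    obtain ⟨I, _, _, ⟨p⟩⟩ := hK X
    refine ⟨SmallDirectedSubsets μ ρ I, inferInstance,
      h.isCardinalFiltered_smallDirectedSubsets, ⟨{
        diag := _
        ι := _
        isColimit := h.isColimitPartialCocone p.isColimit
        prop_diag_obj := fun A ↦ ?_ }⟩⟩
    have := ObjectProperty.isClosedUnderColimitsOfShape_colimitsCardinalClosure P ρ
      (underlyingSets (OrderHom.id (α := SmallDirectedSubsets μ ρ I)) A)
      (hasCardinalLT_arrow_of_preorder h.regular_right.aleph0_le A.2.2)
    exact ObjectProperty.prop_colimit _ _ fun a ↦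
      ObjectProperty.le_colimitsCardinalClosure _ _ _ (p.prop_diag_obj a.1)

lemma SharplyLTRegular.isCardinalAccessibleCategory [LocallySmall.{w} K] [Fact ρ.IsRegular]
    (h : SharplyLTRegular μ ρ) {P : ObjectProperty K} [ObjectProperty.EssentiallySmall.{w} P]
    (hP : P ≤ isCardinalPresentable K ρ)
    (hK : ∀ X : K, ∃ (I : Type w) (_ : PartialOrder I) (_ : IsCardinalFiltered I μ),
      P.colimitsOfShape I X) :
    IsCardinalAccessibleCategory K ρ := by
  have := (h.isCardinalFilteredGenerator_colimitsCardinalClosure hP hK).hasCardinalFilteredGenerator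
  have : HasCardinalFilteredColimits.{w} K ρ := ⟨fun J _ _ ↦
    have := IsCardinalFiltered.of_le J h.lt.le
    HasCardinalFilteredColimits.hasColimitsOfShape (κ := μ) K J⟩
  exact { }

end Accessibility

end Filtration

open Filtration in
theorem mainTheorem7_general {K : Type u} [Category.{v} K] {μ ν θ : Cardinal.{w}}
    [Fact μ.IsRegular] (hν : μ = ν ∨ SharplyLT μ ν ∧ SharplyLT μ (Order.succ ν)) (hθν : θ ≤ ν)
    (hK : IsAccessiblePair K μ θ) : IsFiltrableCategory K (Order.succ ν) := by
  obtain ⟨hθ, hK⟩ := hK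
  have : Fact θ.IsRegular := ⟨hθ⟩
  have hν₀ : Fact (Order.succ ν).IsRegular := ⟨isRegular_succ (hθ.aleph0_le.trans hθν)⟩
  have := hK.locallySmall
  have := hK.hasColimits
  have hsmall := hK.essentiallySmall
  have hsystem := hK.isColimitOfSystem
  simp only [IsColimitOfSystem, presentableLT_succ_eq] at hsmall hsystem
  have hμν : SharplyLTRegular μ (Order.succ ν) := by
    obtain rfl | h := hν
    exacts [sharplyLTRegular_succ_self, h.2.sharplyLTRegular_succ h.1.aleph0_le]
  have hP := isCardinalPresentable_monotone K (hθν.trans (Order.le_succ ν))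
  refine ⟨⟨_, hν₀, hμν.isCardinalAccessibleCategory hP hsystem⟩, fun X hX ↦ ⟨_, hX, ?_⟩⟩
  have := presentable_iff.1 hX.1
  obtain ⟨I, _, _, hXI⟩ := hsystem X
  obtain ⟨A, _, hA, hXA⟩ := hμν.exists_small_colimitsOfShape hP hXI
  rw [Order.lt_succ_iff] at hA
  obtain rfl | h := hν
  · exact isColimitOfChain_succ_of_mk_le hA
      (ObjectProperty.colimitsOfShape_monotone _ (isCardinalPresentable_monotone K hθν) _ hXA)
  · exact h.1.isColimitOfChain_succ hθν le_rfl hA hXA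

theorem mainTheorem7 {K : Type u} [Category.{v} K] (μ : Cardinal.{w}) [Fact μ.IsRegular] :
    (∀ ν : Cardinal.{w}, Filtration.SharplyLT μ ν → Filtration.SharplyLT μ (Order.succ ν) →
      (∀ θ : Cardinal.{w}, θ ≤ ν → Filtration.IsAccessiblePair K μ θ →
        Filtration.IsAlmostFiltrableCategory K (Order.succ ν)) ∧
      (IsCardinalAccessibleCategory K μ → Filtration.IsFiltrableCategory K (Order.succ ν))) ∧
    (IsCardinalAccessibleCategory K μ → Filtration.IsFiltrableCategory K (Order.succ μ)) := by
  refine ⟨fun ν hν hν' ↦ ⟨fun θ hθ hK ↦ ?_, fun _ ↦ ?_⟩, fun _ ↦ ?_⟩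
  · exact (mainTheorem7_general (.inr ⟨hν, hν'⟩) hθ hK).isAlmostFiltrableCategory
  · exact mainTheorem7_general (.inr ⟨hν, hν'⟩) hν.le Filtration.isAccessiblePair_self
  · exact mainTheorem7_general (.inl rfl) le_rfl Filtration.isAccessiblePair_self
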